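/- For a real invertible $n\times n$ matrix $A$ and a full-rank lattice $\Gamma\subset\mathbb R^n$, an $(A,\Gamma)$ wavelet set is a Lebesgue measurable set $W\subset\mathbb R^n$ such that $$\sum_{j\in\mathbb Z}\mathbf 1_W(A^jx)=1\quad\text{and}\quad \sum_{\gamma\in\Gamma}\mathbf 1_W(x+\gamma)=1\qquad\text{for a.e. }x\in\mathbb R^n.$$ Let $e_1,e_2,e_3$ be the standard basis of $\mathbb R^3$. Let $A=\operatorname{diag}(\lambda_1,\lambda_2,\lambda_3)$ with $\lambda_1,\lambda_2,\lambda_3\in\mathbb R$ satisfying $|\lambda_1|\ge|\lambda_2|\ge|\lambda_3|$, $|\det A|=|\lambda_1\lambda_2\lambda_3|>1$ and $|\lambda_1\lambda_3|<1$, and let $a,b\in\mathbb R$ with $a\neq0$ and $b\ne 0$. (1) If $\Gamma\subset\mathbb R^3$ is a full-rank lattice and there exist $\gamma_1,\gamma_2\in\Gamma$ with $\operatorname{span}_{\mathbb R}(\gamma_1,\gamma_2)=\operatorname{span}_{\mathbb R}(ae_1+be_2,e_3)$, then there is no $(A,\Gamma)$ wavelet set. (2) There exists a full-rank lattice $\Gamma\subset\mathbb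 R^3$ containing two such vectors $\gamma_1,\gamma_2$ for which moreover $\Gamma\cap\operatorname{span}_{\mathbb R}(e_3)=\{0\}$. Moreover, real numbers $\lambda_1,\lambda_2,\lambda_3$ satisfying these conditions exist. -/

import Mathlib

open MeasureTheory
open scoped ENNReal

/-- The linear action `x ↦ A x` of a square real matrix on Euclidean space `ℝⁿ`. -/
noncomputable def dilate {n : ℕ} (A : Matrix (Fin n) (Fin n) ℝ) (x : EuclideanSpace ℝ (Fin n)) :
    EuclideanSpace ℝ (Fin n) :=
  WithLp.toLp 2 (A.mulVec x.ofLp)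

/-- `U` packs `M`-redundantly by `A` dilations:
`∑_{j ∈ ℤ} 1_U (A^j x) ≤ M` for almost every `x`. Here `A` is meant to be invertible, so that
the integer power `A ^ j` is the genuine one for negative `j`. -/
def PacksByDilations {n : ℕ} (A : Matrix (Fin n) (Fin n) ℝ) (M : ℕ)
    (U : Set (EuclideanSpace ℝ (Fin n))) : Prop :=
  ∀ᵐ x : EuclideanSpace ℝ (Fin n),
    ∑' j : ℤ, U.indicator (fun _ => (1 : ℝ≥0∞)) (dilate (A ^ j) x) ≤ (M : ℝ≥0∞)

/-- `U` covers by `A` dilations: `∑_{j ∈ ℤ} 1_U (A^j x) ≥ 1` for almost every `x`. -/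
def CoversByDilations {n : ℕ} (A : Matrix (Fin n) (Fin n) ℝ)
    (U : Set (EuclideanSpace ℝ (Fin n))) : Prop :=
  ∀ᵐ x : EuclideanSpace ℝ (Fin n),
    1 ≤ ∑' j : ℤ, U.indicator (fun _ => (1 : ℝ≥0∞)) (dilate (A ^ j) x)

/-- `U` tiles by `A` dilations: it packs (`M = 1`) and covers. -/
def TilesByDilations {n : ℕ} (A : Matrix (Fin n) (Fin n) ℝ)
    (U : Set (EuclideanSpace ℝ (Fin n))) : Prop :=
  PacksByDilations A 1 U ∧ CoversByDilations A U

/-- `V` packs `M`-redundantly by `Γ` translations: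
`∑_{γ ∈ Γ} 1_V (x + γ) ≤ M` for almost every `x`. -/
def PacksByTranslations {n : ℕ} (Γ : Submodule ℤ (EuclideanSpace ℝ (Fin n))) (M : ℕ)
    (V : Set (EuclideanSpace ℝ (Fin n))) : Prop :=
  ∀ᵐ x : EuclideanSpace ℝ (Fin n),
    ∑' γ : Γ, V.indicator (fun _ => (1 : ℝ≥0∞)) (x + (γ : EuclideanSpace ℝ (Fin n))) ≤ (M : ℝ≥0∞)

/-- `V` covers by `Γ` translations: `∑_{γ ∈ Γ} 1_V (x + γ) ≥ 1` for almost every `x`. -/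
def CoversByTranslations {n : ℕ} (Γ : Submodule ℤ (EuclideanSpace ℝ (Fin n)))
    (V : Set (EuclideanSpace ℝ (Fin n))) : Prop :=
  ∀ᵐ x : EuclideanSpace ℝ (Fin n),
    1 ≤ ∑' γ : Γ, V.indicator (fun _ => (1 : ℝ≥0∞)) (x + (γ : EuclideanSpace ℝ (Fin n)))

/-- `V` tiles by `Γ` translations: it packs (`M = 1`) and covers. -/
def TilesByTranslations {n : ℕ} (Γ : Submodule ℤ (EuclideanSpace ℝ (Fin n)))
    (V : Set (EuclideanSpace ℝ (Fin n))) : Prop :=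
  PacksByTranslations Γ 1 V ∧ CoversByTranslations Γ V

/-- An `(A, Γ)` wavelet set: a Lebesgue measurable set (that is, a null-measurable one for the
Borel Lebesgue measure `volume`) which tiles by `A` dilations and by `Γ` translations. -/
def IsWaveletSet {n : ℕ} (A : Matrix (Fin n) (Fin n) ℝ)
    (Γ : Submodule ℤ (EuclideanSpace ℝ (Fin n))) (W : Set (EuclideanSpace ℝ (Fin n))) : Prop :=
  NullMeasurableSet W volume ∧ TilesByDilations A W ∧ TilesByTranslations Γ W

/-- The `i`-th standard unit basis vector `e_i` of `ℝⁿ`. -/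
noncomputable def stdVec {n : ℕ} (i : Fin n) : EuclideanSpace ℝ (Fin n) :=
  EuclideanSpace.single i (1 : ℝ)

/-- The conditions on the diagonal entries: `|λ₁| ≥ |λ₂| ≥ |λ₃|`,
`|det diag(λ₁, λ₂, λ₃)| > 1` and `|λ₁ λ₃| < 1`. -/
def DiagonalCondition (lam : Fin 3 → ℝ) : Prop :=
  |lam 0| ≥ |lam 1| ∧ |lam 1| ≥ |lam 2| ∧ |(Matrix.diagonal lam).det| > 1 ∧ |lam 0 * lam 2| < 1

/-- There are two vectors of `Γ` whose linear span is the plane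
`span (a e₁ + b e₂, e₃)`. -/
def HasPlanePair (Γ : Submodule ℤ (EuclideanSpace ℝ (Fin 3))) (a b : ℝ) : Prop :=
  ∃ γ₁ ∈ Γ, ∃ γ₂ ∈ Γ,
    Submodule.span ℝ {γ₁, γ₂} =
      Submodule.span ℝ {a • stdVec (0 : Fin 3) + b • stdVec (1 : Fin 3), stdVec (2 : Fin 3)}

/-! Covering by dilations conflicts with packing by translations. Almost every point of the ball of
radius `r` about 0 lies in some set `{x | A^j x ∈ W}`. For `j = k ≥ 0` this set has measure `|det
A|^(-k) vol W`, summable in `k` with a sum free of `r`. For `j = -k`, `A^(-k)` maps the ball into a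
slab `|b x₀ - a x₁| ≤ w` with `w` proportional to `r |lam 1|^(-k)`. Since `Γ` contains two vectors
spanning the plane of the slab, the part of `W` there has measure O(w)
(`HasPlanePair.exists_measure_inter_slab_le`). Pulling back multiplies this by `|det A|^k` and
leaves O(`r |lam 0 * lam 2|^k`), again summable. Hence `r³ v ≤ c₀ + c₁ r` with `v > 0`, which fails
for large `r`. In the existence part, the irrationality of √2 keeps the lattice off the third axis.
-/

/-- If `W` packs by `Γ` translations and every point of `S` is `Γ`-congruent to a point of `F`,
then the part of `W` in `S` has at most the measure of `F`. -/
theorem PacksByTranslations.measure_inter_le {n : ℕ}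
    {Γ : Submodule ℤ (EuclideanSpace ℝ (Fin n))} [Countable Γ]
    {W S F : Set (EuclideanSpace ℝ (Fin n))} (hW : PacksByTranslations Γ 1 W)
    (hWm : NullMeasurableSet W volume) (hF : MeasurableSet F)
    (hS : ∀ x ∈ S, ∃ γ : Γ, x - (γ : EuclideanSpace ℝ (Fin n)) ∈ F) :
    volume (W ∩ S) ≤ volume F := by
  have hmp : ∀ γ : Γ, MeasurePreserving
      (fun x : EuclideanSpace ℝ (Fin n) => x + (γ : EuclideanSpace ℝ (Fin n))) volume volume :=
    fun γ => measurePreserving_add_right volume _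
  have hWt : ∀ γ : Γ, NullMeasurableSet
      ((fun x : EuclideanSpace ℝ (Fin n) => x + (γ : EuclideanSpace ℝ (Fin n))) ⁻¹' W) volume :=
    fun γ => hWm.preimage (hmp γ).quasiMeasurePreserving
  have hsub : W ∩ S ⊆ ⋃ γ : Γ, (fun x => x - (γ : EuclideanSpace ℝ (Fin n))) ⁻¹'
      (((fun x => x + (γ : EuclideanSpace ℝ (Fin n))) ⁻¹' W) ∩ F) := by
    rintro x ⟨hxW, hxS⟩
    obtain ⟨γ, hγ⟩ := hS x hxS
    refine Set.mem_iUnion.2 ⟨γ, ?_, hγ⟩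
    simpa using hxW
  calc volume (W ∩ S)
      ≤ ∑' γ : Γ, volume ((fun x => x - (γ : EuclideanSpace ℝ (Fin n))) ⁻¹'
          (((fun x => x + (γ : EuclideanSpace ℝ (Fin n))) ⁻¹' W) ∩ F)) :=
        (measure_mono hsub).trans (measure_iUnion_le _)
    _ = ∑' γ : Γ, volume (((fun x => x + (γ : EuclideanSpace ℝ (Fin n))) ⁻¹' W) ∩ F) := by
        refine tsum_congr fun γ => ?_
        exact (measurePreserving_sub_right volume _).measure_preimage
          ((hWt γ).inter hF.nullMeasurableSet)
    _ = ∑' γ : Γ, ∫⁻ x in F, W.indicator (fun _ => (1 : ℝ≥0∞))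
          (x + (γ : EuclideanSpace ℝ (Fin n))) := by
        refine tsum_congr fun γ => ?_
        rw [← Measure.restrict_apply₀' hF.nullMeasurableSet,
          ← lintegral_indicator_one₀ ((hWt γ).mono_ac Measure.restrict_le_self.absolutelyContinuous)]
        rfl
    _ = ∫⁻ x in F, ∑' γ : Γ, W.indicator (fun _ => (1 : ℝ≥0∞))
          (x + (γ : EuclideanSpace ℝ (Fin n))) := by
        refine (lintegral_tsum fun γ => ?_).symm
        exact (aemeasurable_const (b := (1 : ℝ≥0∞))).indicator₀
          ((hWt γ).mono_ac Measure.restrict_le_self.absolutelyContinuous)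
    _ ≤ ∫⁻ _ in F, 1 := lintegral_mono_ae
        ((ae_restrict_of_ae hW).mono fun x hx => by simpa using hx)
    _ = volume F := by simp

/-- A set packing by translations of a full-rank lattice has finite measure. -/
theorem PacksByTranslations.measure_lt_top {n : ℕ}
    {Γ : Submodule ℤ (EuclideanSpace ℝ (Fin n))} [DiscreteTopology Γ] [IsZLattice ℝ Γ]
    {W : Set (EuclideanSpace ℝ (Fin n))} (hW : PacksByTranslations Γ 1 W)
    (hWm : NullMeasurableSet W volume) : volume W < ∞ := by
  let B := (Module.Free.chooseBasis ℤ Γ).ofZLatticeBasis ℝ Γ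
  have hle : volume (W ∩ Set.univ) ≤ volume (ZSpan.fundamentalDomain B) := by
    refine hW.measure_inter_le hWm (ZSpan.fundamentalDomain_measurableSet B) fun x _ => ?_
    have hmem : (ZSpan.floor B x : EuclideanSpace ℝ (Fin n)) ∈ Γ :=
      ((Module.Free.chooseBasis ℤ Γ).ofZLatticeBasis_span ℝ).le (ZSpan.floor B x).2
    exact ⟨⟨_, hmem⟩, ZSpan.fract_mem_fundamentalDomain B x⟩
  rw [Set.inter_univ] at hle
  exact hle.trans_lt (ZSpan.fundamentalDomain_isBounded B).measure_lt_top

/-! ### Powers of a diagonal matrix as dilations -/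

theorem volume_preimage_dilate {n : ℕ} {A : Matrix (Fin n) (Fin n) ℝ} (hA : A.det ≠ 0)
    (s : Set (EuclideanSpace ℝ (Fin n))) :
    volume (dilate A ⁻¹' s) = ENNReal.ofReal |A.det⁻¹| * volume s := by
  have h := Measure.addHaar_preimage_linearMap (volume : Measure (EuclideanSpace ℝ (Fin n)))
    (f := A.toLpLin 2 2) (by rwa [LinearMap.det_toLpLin]) s
  rwa [LinearMap.det_toLpLin] at h

theorem diagonal_zpow {n : ℕ} {d : Fin n → ℝ} (hd : ∀ i, d i ≠ 0) (j : ℤ) :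
    Matrix.diagonal d ^ j = Matrix.diagonal fun i => d i ^ j := by
  have hnat : ∀ k : ℕ, Matrix.diagonal d ^ k = Matrix.diagonal fun i => d i ^ k := fun k => by
    rw [Matrix.diagonal_pow]; rfl
  obtain ⟨k, rfl | rfl⟩ := j.eq_nat_or_neg
  · simp only [zpow_natCast, hnat]
  · rw [Matrix.zpow_neg_natCast, hnat]
    refine Matrix.inv_eq_right_inv ?_
    rw [Matrix.diagonal_mul_diagonal, ← Matrix.diagonal_one]
    congr 1
    funext i
    simp [hd i]

theorem det_diagonal_zpow {n : ℕ} {d : Fin n → ℝ} (hd : ∀ i, d i ≠ 0) (j : ℤ) :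
    (Matrix.diagonal d ^ j).det = (Matrix.diagonal d).det ^ j := by
  rw [diagonal_zpow hd, Matrix.det_diagonal, Matrix.det_diagonal, Finset.prod_zpow]

theorem dilate_diagonal_zpow_apply {n : ℕ} {d : Fin n → ℝ} (hd : ∀ i, d i ≠ 0) (j : ℤ)
    (x : EuclideanSpace ℝ (Fin n)) (i : Fin n) :
    dilate (Matrix.diagonal d ^ j) x i = d i ^ j * x i := by
  simp [dilate, diagonal_zpow hd, Matrix.mulVec_diagonal]

/-! ### Slabs around the rational plane -/

/-- If `Γ` contains two vectors spanning the plane `b x₀ = a x₁, x₂` arbitrary, then every point of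
the space can be moved by a vector of `Γ` in that plane to one with bounded coordinates `0`
and `2`. -/
theorem HasPlanePair.exists_reduction {Γ : Submodule ℤ (EuclideanSpace ℝ (Fin 3))} {a b : ℝ}
    (h : HasPlanePair Γ a b) (ha : a ≠ 0) :
    ∃ C : ℝ, ∀ x : EuclideanSpace ℝ (Fin 3), ∃ γ : Γ,
      |(x - (γ : EuclideanSpace ℝ (Fin 3))) 0| ≤ C ∧ |(x - (γ : EuclideanSpace ℝ (Fin 3))) 2| ≤ C ∧
      b * (x - (γ : EuclideanSpace ℝ (Fin 3))) 0 - a * (x - (γ : EuclideanSpace ℝ (Fin 3))) 1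
        = b * x 0 - a * x 1 := by
  obtain ⟨g, hg, g', hg', hspan⟩ := h
  have hplane : ∀ v ∈ Submodule.span ℝ {g, g'}, b * v 0 - a * v 1 = 0 := by
    intro v hv
    rw [hspan, Submodule.mem_span_pair] at hv
    obtain ⟨s, t, rfl⟩ := hv
    simp [stdVec]
    ring
  have hg0 := hplane g (Submodule.subset_span (by simp))
  have hg0' := hplane g' (Submodule.subset_span (by simp))
  refine ⟨|g 0| + |g' 0| + (|g 2| + |g' 2|), fun x => ?_⟩
  -- The point of the plane that agrees with `x` in coordinates 0 and 2.
  have hx : (x 0 / a) • (a • stdVec (0 : Fin 3) + b • stdVec (1 : Fin 3))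
      + x 2 • stdVec (2 : Fin 3) ∈ Submodule.span ℝ {g, g'} := by
    rw [hspan, Submodule.mem_span_pair]
    exact ⟨_, _, rfl⟩
  obtain ⟨s, t, hst⟩ := Submodule.mem_span_pair.1 hx
  have h0 : s * g 0 + t * g' 0 = x 0 := by
    have := congrArg (fun v : EuclideanSpace ℝ (Fin 3) => v 0) hst
    simpa [stdVec, ha] using this
  have h2 : s * g 2 + t * g' 2 = x 2 := by
    have := congrArg (fun v : EuclideanSpace ℝ (Fin 3) => v 2) hst
    simpa [stdVec] using this
  have hbound : ∀ p q : ℝ, |Int.fract s * p + Int.fract t * q| ≤ |p| + |q| := fun p q => by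
    refine (abs_add_le _ _).trans (add_le_add ?_ ?_) <;>
    · rw [abs_mul, Int.abs_fract]
      exact mul_le_of_le_one_left (abs_nonneg _) (Int.fract_lt_one _).le
  -- Subtracting the integer parts leaves fractional parts in coordinates 0 and 2; vectors of the
  -- plane do not change `b x₀ - a x₁`.
  refine ⟨⟨⌊s⌋ • g + ⌊t⌋ • g', Γ.add_mem (Γ.smul_mem _ hg) (Γ.smul_mem _ hg')⟩, ?_, ?_, ?_⟩
  · have e : (x - (⌊s⌋ • g + ⌊t⌋ • g')) 0 = Int.fract s * g 0 + Int.fract t * g' 0 := by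
      simp only [PiLp.sub_apply, PiLp.add_apply, PiLp.smul_apply, zsmul_eq_mul, ← h0, Int.fract]
      ring
    simp only [e]
    have := hbound (g 0) (g' 0)
    have := abs_nonneg (g 2)
    have := abs_nonneg (g' 2)
    linarith
  · have e : (x - (⌊s⌋ • g + ⌊t⌋ • g')) 2 = Int.fract s * g 2 + Int.fract t * g' 2 := by
      simp only [PiLp.sub_apply, PiLp.add_apply, PiLp.smul_apply, zsmul_eq_mul, ← h2, Int.fract]
      ring
    simp only [e]
    have := hbound (g 2) (g' 2)
    have := abs_nonneg (g 0)
    have := abs_nonneg (g' 0)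
    linarith
  · simp only [PiLp.sub_apply, PiLp.add_apply, PiLp.smul_apply, zsmul_eq_mul]
    linear_combination (-(⌊s⌋ : ℝ)) * hg0 - (⌊t⌋ : ℝ) * hg0'

/-- A set packing by translations of a lattice meeting the plane `b x₀ = a x₁` in a rank two
lattice occupies, in a slab around this plane, measure at most proportional to the width. -/
theorem HasPlanePair.exists_measure_inter_slab_le {Γ : Submodule ℤ (EuclideanSpace ℝ (Fin 3))}
    [Countable Γ] {a b : ℝ} (h : HasPlanePair Γ a b) (ha : a ≠ 0)
    {W : Set (EuclideanSpace ℝ (Fin 3))} (hW : PacksByTranslations Γ 1 W)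
    (hWm : NullMeasurableSet W volume) :
    ∃ D : ℝ≥0∞, D < ∞ ∧ ∀ w : ℝ, 0 < w →
      volume (W ∩ {x | |b * x 0 - a * x 1| ≤ w}) ≤ ENNReal.ofReal w * D := by
  obtain ⟨C, hC⟩ := h.exists_reduction ha
  let Q : Set (EuclideanSpace ℝ (Fin 3)) := {y | |y 0| ≤ C ∧ |y 1| ≤ 1 ∧ |y 2| ≤ C}
  have hQm : MeasurableSet Q := by
    have hm : ∀ (i : Fin 3) (c : ℝ), MeasurableSet {y : EuclideanSpace ℝ (Fin 3) | |y i| ≤ c} :=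
      fun i c => measurableSet_le (by fun_prop) measurable_const
    exact (hm 0 C).inter ((hm 1 1).inter (hm 2 C))
  have hQb : Bornology.IsBounded Q := by
    refine (Metric.isBounded_closedBall (x := 0) (r := C + 1 + C)).subset ?_
    rintro y ⟨h0, h1, h2⟩
    have hC0 : 0 ≤ C := (abs_nonneg _).trans h0
    rw [mem_closedBall_zero_iff, EuclideanSpace.norm_eq, Fin.sum_univ_three]
    refine Real.sqrt_le_iff.2 ⟨by linarith, ?_⟩
    simp only [Real.norm_eq_abs]
    nlinarith [abs_nonneg (y 0), abs_nonneg (y 1), abs_nonneg (y 2)]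
  refine ⟨ENNReal.ofReal |a⁻¹| * volume Q,
    ENNReal.mul_lt_top ENNReal.ofReal_lt_top hQb.measure_lt_top, fun w hw => ?_⟩
  -- `M` replaces coordinate 1 by `(b x₀ - a x₁) / w`, so one fixed box `Q` serves every width; its
  -- determinant `-a / w` produces the factor `w`.
  let M : Matrix (Fin 3) (Fin 3) ℝ := !![1, 0, 0; b / w, -a / w, 0; 0, 0, 1]
  have hMdet : M.det = -a / w := by simp [M, Matrix.det_fin_three]
  have hM : M.det ≠ 0 := by
    rw [hMdet]
    exact div_ne_zero (neg_ne_zero.2 ha) hw.ne'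
  have hMapp : ∀ x : EuclideanSpace ℝ (Fin 3),
      dilate M x 0 = x 0 ∧ dilate M x 1 = (b * x 0 - a * x 1) / w ∧ dilate M x 2 = x 2 := by
    intro x
    refine ⟨?_, ?_, ?_⟩ <;> simp [dilate, M, dotProduct, Fin.sum_univ_three]
    ring
  have hcont : Measurable (dilate M) :=
    ((M.toLpLin 2 2).continuous_of_finiteDimensional).measurable
  have hle : volume (W ∩ {x | |b * x 0 - a * x 1| ≤ w}) ≤ volume (dilate M ⁻¹' Q) := by
    refine hW.measure_inter_le hWm (hcont hQm) fun x hx => ?_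
    obtain ⟨γ, h0, h2, h1⟩ := hC x
    refine ⟨γ, ?_⟩
    obtain ⟨e0, e1, e2⟩ := hMapp (x - γ)
    refine ⟨by rwa [e0], ?_, by rwa [e2]⟩
    rw [e1, h1, abs_div, abs_of_pos hw]
    exact div_le_one_of_le₀ hx hw.le
  refine hle.trans (le_of_eq ?_)
  rw [volume_preimage_dilate hM, hMdet, ← mul_assoc, ← ENNReal.ofReal_mul hw.le]
  congr 2
  rw [inv_div, abs_div, abs_neg, abs_inv, abs_of_pos hw, div_eq_mul_inv]

/-! ### Dilation estimates and the contradiction -/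

theorem tsum_ofReal_pow_lt_top {q : ℝ} (hq0 : 0 ≤ q) (hq : q < 1) :
    ∑' k : ℕ, ENNReal.ofReal (q ^ k) < ∞ := by
  rw [← ENNReal.ofReal_tsum_of_nonneg (fun k => pow_nonneg hq0 k)
    (summable_geometric_of_lt_one hq0 hq)]
  exact ENNReal.ofReal_lt_top

/-- A cubic with positive leading coefficient is not bounded by an affine function. -/
theorem exists_affine_lt_cube {v c₀ c₁ : ℝ≥0∞} (hv : 0 < v) (hv' : v < ∞) (h₀ : c₀ < ∞)
    (h₁ : c₁ < ∞) :
    ∃ r : ℝ, 0 < r ∧ c₀ + ENNReal.ofReal r * c₁ < ENNReal.ofReal (r ^ 3) * v := by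
  lift v to NNReal using hv'.ne
  lift c₀ to NNReal using h₀.ne
  lift c₁ to NNReal using h₁.ne
  have hv : (0 : ℝ) < v := by exact_mod_cast hv
  have hc : (0 : ℝ) ≤ (c₀ + c₁) / v := by positivity
  -- Chosen so that `r ≥ 1` and `r * v > c₀ + c₁`.
  set r : ℝ := 1 + (c₀ + c₁) / v with hr
  have hr1 : 1 ≤ r := by linarith
  refine ⟨r, by linarith, ?_⟩
  rw [← ENNReal.ofReal_coe_nnreal (p := v), ← ENNReal.ofReal_coe_nnreal (p := c₀),
    ← ENNReal.ofReal_coe_nnreal (p := c₁), ← ENNReal.ofReal_mul (by linarith),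
    ← ENNReal.ofReal_mul (by positivity), ← ENNReal.ofReal_add (by positivity) (by positivity)]
  refine (ENNReal.ofReal_lt_ofReal_iff (by positivity)).2 ?_
  have hrv : (c₀ + c₁ : ℝ) < r * v := by
    rw [hr, add_mul, div_mul_cancel₀ _ hv.ne']
    linarith
  have hr2 : r ≤ r ^ 2 := by nlinarith
  calc (c₀ : ℝ) + r * c₁ ≤ r ^ 2 * (c₀ + c₁) := by
        nlinarith [c₀.coe_nonneg, c₁.coe_nonneg,
          mul_le_mul_of_nonneg_right hr2 c₁.coe_nonneg,
          mul_le_mul_of_nonneg_right (hr1.trans hr2) c₀.coe_nonneg]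
    _ < r ^ 2 * (r * v) := mul_lt_mul_of_pos_left hrv (by positivity)
    _ = r ^ 3 * v := by ring

theorem DiagonalCondition.ne_zero {lam : Fin 3 → ℝ} (h : DiagonalCondition lam) (i : Fin 3) :
    lam i ≠ 0 := by
  intro hi
  have hdet := h.2.2.1
  rw [Matrix.det_diagonal, Finset.prod_eq_zero (Finset.mem_univ i) hi, abs_zero] at hdet
  linarith

/-- The points of the ball of radius `r` which `A⁻ᵏ` maps into `W` have measure at most a constant
times `r |λ₀ λ₂|ᵏ`. -/
theorem HasPlanePair.exists_measure_ball_inter_le {lam : Fin 3 → ℝ} (hlam : DiagonalCondition lam)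
    {Γ : Submodule ℤ (EuclideanSpace ℝ (Fin 3))} [Countable Γ] {a b : ℝ} (h : HasPlanePair Γ a b)
    (ha : a ≠ 0) {W : Set (EuclideanSpace ℝ (Fin 3))} (hW : PacksByTranslations Γ 1 W)
    (hWm : NullMeasurableSet W volume) :
    ∃ D : ℝ≥0∞, D < ∞ ∧ ∀ r : ℝ, 0 < r → ∀ k : ℕ,
      volume (Metric.closedBall 0 r ∩ dilate (Matrix.diagonal lam ^ (-(k : ℤ))) ⁻¹' W)
        ≤ ENNReal.ofReal r * D * ENNReal.ofReal (|lam 0 * lam 2| ^ k) := by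
  obtain ⟨D, hD, hslab⟩ := h.exists_measure_inter_slab_le ha hW hWm
  have hne := hlam.ne_zero
  have h0 := abs_pos.2 (hne 0)
  have h1 := abs_pos.2 (hne 1)
  have h2 := abs_pos.2 (hne 2)
  have hdet : (Matrix.diagonal lam).det = lam 0 * lam 1 * lam 2 := by
    rw [Matrix.det_diagonal, Fin.prod_univ_three]
  refine ⟨ENNReal.ofReal (|a| + |b|) * D, ENNReal.mul_lt_top ENNReal.ofReal_lt_top hD,
    fun r hr k => ?_⟩
  have hab : 0 < |a| + |b| := add_pos_of_pos_of_nonneg (abs_pos.2 ha) (abs_nonneg b)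
  set w : ℝ := (|a| + |b|) * r * (|lam 1| ^ k)⁻¹ with hw
  have hsub : Metric.closedBall 0 r ∩ dilate (Matrix.diagonal lam ^ (-(k : ℤ))) ⁻¹' W ⊆
      dilate (Matrix.diagonal lam ^ (-(k : ℤ))) ⁻¹' (W ∩ {x | |b * x 0 - a * x 1| ≤ w}) := by
    rintro x ⟨hx, hxW⟩
    refine ⟨hxW, ?_⟩
    rw [mem_closedBall_zero_iff] at hx
    have hx0 : |x 0| ≤ r := (PiLp.norm_apply_le x 0).trans hx
    have hx1 : |x 1| ≤ r := (PiLp.norm_apply_le x 1).trans hx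
    -- Coordinate 0 contracts at least as fast as coordinate 1, so `lam 1` governs the width.
    have hinv : (|lam 0| ^ k)⁻¹ ≤ (|lam 1| ^ k)⁻¹ :=
      inv_anti₀ (by positivity) (pow_le_pow_left₀ h1.le hlam.1 k)
    simp only [Set.mem_ofPred_eq, dilate_diagonal_zpow_apply hne]
    calc |b * (lam 0 ^ (-(k : ℤ)) * x 0) - a * (lam 1 ^ (-(k : ℤ)) * x 1)|
        ≤ |b * (lam 0 ^ (-(k : ℤ)) * x 0)| + |a * (lam 1 ^ (-(k : ℤ)) * x 1)| := abs_sub _ _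
      _ = |b| * ((|lam 0| ^ k)⁻¹ * |x 0|) + |a| * ((|lam 1| ^ k)⁻¹ * |x 1|) := by
        simp only [abs_mul, zpow_neg, zpow_natCast, abs_inv, abs_pow]
      _ ≤ |b| * ((|lam 1| ^ k)⁻¹ * r) + |a| * ((|lam 1| ^ k)⁻¹ * r) := by gcongr
      _ = w := by rw [hw]; ring
  have hdet0 : (Matrix.diagonal lam ^ (-(k : ℤ))).det ≠ 0 := by
    rw [det_diagonal_zpow hne, hdet]
    exact zpow_ne_zero _ (mul_ne_zero (mul_ne_zero (hne 0) (hne 1)) (hne 2))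
  calc _ ≤ _ := measure_mono hsub
    _ = ENNReal.ofReal |(Matrix.diagonal lam ^ (-(k : ℤ))).det⁻¹| *
        volume (W ∩ {x | |b * x 0 - a * x 1| ≤ w}) := volume_preimage_dilate hdet0 _
    _ ≤ ENNReal.ofReal |(Matrix.diagonal lam ^ (-(k : ℤ))).det⁻¹| * (ENNReal.ofReal w * D) := by
        gcongr
        exact hslab w (by positivity)
    _ = ENNReal.ofReal (|(Matrix.diagonal lam ^ (-(k : ℤ))).det⁻¹| * w) * D := by
        rw [← mul_assoc, ENNReal.ofReal_mul (abs_nonneg _)]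
    _ = ENNReal.ofReal (r * (|a| + |b|) * |lam 0 * lam 2| ^ k) * D := by
        congr 2
        -- The factor `|lam 1| ^ k` of the determinant cancels against the width.
        rw [det_diagonal_zpow hne, hdet, hw, zpow_neg, inv_inv, zpow_natCast, abs_pow]
        simp only [abs_mul, mul_pow]
        field_simp
    _ = _ := by
        rw [ENNReal.ofReal_mul (by positivity), ENNReal.ofReal_mul hr.le]
        ring

/-- The exponent 0 occurs in both sums, which is harmless for an upper bound. -/
theorem CoversByDilations.measure_le {n : ℕ} {A : Matrix (Fin n) (Fin n) ℝ}
    {W : Set (EuclideanSpace ℝ (Fin n))} (hW : CoversByDilations A W)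
    (B : Set (EuclideanSpace ℝ (Fin n))) :
    volume B ≤ ∑' k : ℕ, volume (B ∩ dilate (A ^ (k : ℤ)) ⁻¹' W) +
      ∑' k : ℕ, volume (B ∩ dilate (A ^ (-(k : ℤ))) ⁻¹' W) := by
  have hae : B ≤ᵐ[volume] ((⋃ k : ℕ, B ∩ dilate (A ^ (k : ℤ)) ⁻¹' W) ∪
      ⋃ k : ℕ, B ∩ dilate (A ^ (-(k : ℤ))) ⁻¹' W : Set _) := by
    filter_upwards [hW] with x hx hxB
    obtain ⟨j, hj⟩ : ∃ j : ℤ, dilate (A ^ j) x ∈ W := by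
      by_contra! hno
      simp [hno] at hx
    obtain ⟨k, rfl | rfl⟩ := j.eq_nat_or_neg
    · exact Or.inl (Set.mem_iUnion.2 ⟨k, hxB, hj⟩)
    · exact Or.inr (Set.mem_iUnion.2 ⟨k, hxB, hj⟩)
  exact (measure_mono_ae hae).trans ((measure_union_le _ _).trans
    (add_le_add (measure_iUnion_le _) (measure_iUnion_le _)))

theorem HasPlanePair.not_exists_isWaveletSet {lam : Fin 3 → ℝ} (hlam : DiagonalCondition lam)
    {Γ : Submodule ℤ (EuclideanSpace ℝ (Fin 3))} [DiscreteTopology Γ] [IsZLattice ℝ Γ] {a b : ℝ}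
    (h : HasPlanePair Γ a b) (ha : a ≠ 0) :
    ¬ ∃ W : Set (EuclideanSpace ℝ (Fin 3)), IsWaveletSet (Matrix.diagonal lam) Γ W := by
  rintro ⟨W, hWm, ⟨-, hcov⟩, ⟨hpack, -⟩⟩
  obtain ⟨D, hD, hneg⟩ := h.exists_measure_ball_inter_le hlam ha hpack hWm
  have hne := hlam.ne_zero
  have hdet := hlam.2.2.1
  have hdet0 : (Matrix.diagonal lam).det ≠ 0 := abs_pos.1 (by linarith)
  have hpos : ∀ (r : ℝ) (k : ℕ),
      volume (Metric.closedBall 0 r ∩ dilate (Matrix.diagonal lam ^ (k : ℤ)) ⁻¹' W)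
        ≤ volume W * ENNReal.ofReal (|(Matrix.diagonal lam).det|⁻¹ ^ k) := fun r k => by
    refine (measure_mono Set.inter_subset_right).trans (le_of_eq ?_)
    have hk := det_diagonal_zpow hne (k : ℤ)
    rw [volume_preimage_dilate (hk ▸ zpow_ne_zero _ hdet0), hk, zpow_natCast, mul_comm, abs_inv,
      abs_pow, inv_pow]
  obtain ⟨r, hr, hlt⟩ := exists_affine_lt_cube
    (Metric.measure_closedBall_pos volume (0 : EuclideanSpace ℝ (Fin 3)) one_pos)
    measure_closedBall_lt_top
    (ENNReal.mul_lt_top (hpack.measure_lt_top hWm)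
      (tsum_ofReal_pow_lt_top (inv_nonneg.2 (abs_nonneg _)) (inv_lt_one_of_one_lt₀ hdet)))
    (ENNReal.mul_lt_top hD (tsum_ofReal_pow_lt_top (abs_nonneg _) hlam.2.2.2))
  refine hlt.not_ge ?_
  have hball : volume (Metric.closedBall (0 : EuclideanSpace ℝ (Fin 3)) r) =
      ENNReal.ofReal (r ^ 3) * volume (Metric.closedBall (0 : EuclideanSpace ℝ (Fin 3)) 1) := by
    simpa using Measure.addHaar_closedBall' volume (0 : EuclideanSpace ℝ (Fin 3)) hr.le
  rw [← hball, ← mul_assoc, ← ENNReal.tsum_mul_left, ← ENNReal.tsum_mul_left]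
  exact (hcov.measure_le _).trans
    (add_le_add (ENNReal.tsum_le_tsum (hpos r)) (ENNReal.tsum_le_tsum (hneg r hr)))

/-! ### Existence of the lattice and of the diagonal entries -/

theorem exists_lattice_hasPlanePair (a : ℝ) {b : ℝ} (hb : b ≠ 0) :
    ∃ Γ : Submodule ℤ (EuclideanSpace ℝ (Fin 3)), ∃ _ : DiscreteTopology Γ,
      IsZLattice ℝ Γ ∧ HasPlanePair Γ a b ∧
        (Γ : Set (EuclideanSpace ℝ (Fin 3))) ∩ (Submodule.span ℝ {stdVec (2 : Fin 3)} : Set _)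
          = {0} := by
  have hs : √2 ≠ 0 := by positivity
  let u : EuclideanSpace ℝ (Fin 3) := a • stdVec (0 : Fin 3) + b • stdVec (1 : Fin 3)
  -- The first two vectors span the plane over ℝ, while their components along `u` are 1 and √2,
  -- independent over ℚ.
  let v : Fin 3 → EuclideanSpace ℝ (Fin 3) := ![u + stdVec 2, √2 • u, stdVec 0]
  have hli : LinearIndependent ℝ v := by
    rw [Fintype.linearIndependent_iff]
    intro g hg
    have h0 := congrArg (fun x : EuclideanSpace ℝ (Fin 3) => x 0) hg
    have h1 := congrArg (fun x : EuclideanSpace ℝ (Fin 3) => x 1) hg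
    have h2 := congrArg (fun x : EuclideanSpace ℝ (Fin 3) => x 2) hg
    simp [Fin.sum_univ_three, v, u, stdVec] at h0 h1 h2
    simp [h2, hb] at h1
    simp [h2, h1] at h0
    intro i
    fin_cases i <;> assumption
  let B := basisOfLinearIndependentOfCardEqFinrank hli (by simp)
  have hB : ⇑B = v := coe_basisOfLinearIndependentOfCardEqFinrank hli (by simp)
  have hmem : ∀ i, v i ∈ Submodule.span ℤ (Set.range B) := fun i =>
    Submodule.subset_span (hB ▸ Set.mem_range_self i)
  refine ⟨Submodule.span ℤ (Set.range B), inferInstance, inferInstance,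
    ⟨v 0, hmem 0, v 1, hmem 1, ?_⟩, ?_⟩
  · apply le_antisymm <;> rw [Submodule.span_le, Set.insert_subset_iff, Set.singleton_subset_iff] <;>
      simp only [SetLike.mem_coe, Submodule.mem_span_pair]
    · exact ⟨⟨1, 1, by simp [v, u]⟩, ⟨√2, 0, by simp [v, u]⟩⟩
    · refine ⟨⟨0, (√2)⁻¹, by simp [v, u, smul_smul, hs]⟩, ⟨1, -(√2)⁻¹, ?_⟩⟩
      simp [v, u, smul_smul, hs]
      abel
  · ext x
    refine ⟨fun ⟨hx, hx'⟩ => ?_, ?_⟩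
    · obtain ⟨c, rfl⟩ := (Submodule.mem_span_range_iff_exists_fun ℤ).1 hx
      obtain ⟨t, ht⟩ := Submodule.mem_span_singleton.1 hx'
      rw [hB] at ht ⊢
      have h0 := congrArg (fun x : EuclideanSpace ℝ (Fin 3) => x 0) ht
      have h1 := congrArg (fun x : EuclideanSpace ℝ (Fin 3) => x 1) ht
      simp [Fin.sum_univ_three, v, u, stdVec] at h0 h1
      -- On the third axis coordinate 1 vanishes, and `stdVec 0` does not contribute to it.
      have hlin : (c 0 : ℝ) + c 1 * √2 = 0 := by
        have : b * ((c 0 : ℝ) + c 1 * √2) = 0 := by linear_combination -h1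
        exact (mul_eq_zero.1 this).resolve_left hb
      have hc1 : c 1 = 0 := by
        by_contra hc
        have hc' : (c 1 : ℝ) ≠ 0 := by exact_mod_cast hc
        refine irrational_sqrt_two ⟨-(c 0 : ℚ) / c 1, ?_⟩
        push_cast
        rw [div_eq_iff hc']
        linear_combination -hlin
      have hc0 : c 0 = 0 := by
        rw [hc1] at hlin
        simpa using hlin
      have hc2 : c 2 = 0 := by
        simp [hc0, hc1] at h0
        exact_mod_cast h0.symm
      simp [Fin.sum_univ_three, hc0, hc1, hc2]
    · rintro rfl
      exact ⟨Submodule.zero_mem _, Submodule.zero_mem _⟩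

theorem exists_diagonalCondition : ∃ lam : Fin 3 → ℝ, DiagonalCondition lam := by
  -- The determinant is 8/5 and the outer product is 4/5.
  refine ⟨![2, 2, 2 / 5], ?_, ?_, ?_, ?_⟩
  · simp
  · simp only [Matrix.cons_val]
    norm_num
  · rw [Matrix.det_diagonal, Fin.prod_univ_three]
    simp only [Matrix.cons_val]
    norm_num
  · simp only [Matrix.cons_val]
    norm_num

theorem mainTheorem8 :
    (∀ lam : Fin 3 → ℝ, DiagonalCondition lam → ∀ a b : ℝ, a ≠ 0 → b ≠ 0 →
      (∀ Γ : Submodule ℤ (EuclideanSpace ℝ (Fin 3)), ∀ [DiscreteTopology Γ], ∀ [IsZLattice ℝ Γ],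
        HasPlanePair Γ a b →
          ¬ ∃ W : Set (EuclideanSpace ℝ (Fin 3)), IsWaveletSet (Matrix.diagonal lam) Γ W) ∧
      (∃ Γ : Submodule ℤ (EuclideanSpace ℝ (Fin 3)), ∃ _ : DiscreteTopology Γ,
        IsZLattice ℝ Γ ∧ HasPlanePair Γ a b ∧
          (Γ : Set (EuclideanSpace ℝ (Fin 3))) ∩ (Submodule.span ℝ {stdVec (2 : Fin 3)} : Set _)
            = {0})) ∧
    (∃ lam : Fin 3 → ℝ, DiagonalCondition lam) := by
  refine ⟨fun lam hlam a _ ha hb => ⟨fun Γ _ _ h => ?_, exists_lattice_hasPlanePair a hb⟩,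
    exists_diagonalCondition⟩
  exact h.not_exists_isWaveletSet hlam ha
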